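/- Let $X$ be a metric space that is absolute Souslin-$\mathcal F$, i.e. $X$, viewed as a subset of its metric completion $\widetilde X$, has the form $\bigcup_{\nu\in\omega^\omega}\bigcap_{n\in\omega}F_{\nu|n}$ for some family $(F_s)_{s\in\omega^{<\omega}}$ of closed subsets of $\widetilde X$, where $\nu|n=(\nu(0),\dots,\nu(n-1))$. Let $Y$ be a regular topological space. Call a function $g\colon Z\to Y$ on a metric space $Z$ *$\boldsymbol\Sigma^0_2$-measurable* if $g^{-1}(U)$ is a countable union of closed subsets of $Z$ for every open $U\subset Y$, and *piecewise continuous* if $Z$ can be covered by a sequence $Z_0,Z_1,\dots$ of closed subsets such that $g\restriction Z_n$ is continuous for every $n$. If $f\colon X\to Y$ is $\boldsymbol\Sigma^0_2$-measurable and not piecewise continuous, then there is a Cantor set $K\subset X$ (i.e. a subspace homeomorphic to the Cantor space $2^\omega$) such that $f\restriction K\colon K\to Y$ is $\boldsymbol\Sigma^0_2$-measurable and not piecewise continuous. -/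

import Mathlib

namespace JayneRogers

/-- The initial segment `ν|n = (ν 0, …, ν (n - 1))` of an infinite sequence. -/
def initSeg (ν : ℕ → ℕ) (n : ℕ) : List ℕ :=
  List.ofFn fun i : Fin n => ν i

/-- The Souslin operation applied to a scheme of sets indexed by the finite sequences of natural
numbers: the union over all infinite sequences `ν` of the intersections of the sets `P (ν|n)`. -/
def souslinOperation {Z : Type*} (P : List ℕ → Set Z) : Set Z :=
  ⋃ ν : ℕ → ℕ, ⋂ n : ℕ, P (initSeg ν n)

/-- Souslin-F sets: results of the Souslin operation on schemes of closed sets. -/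
def IsSouslinF {Z : Type*} [TopologicalSpace Z] (A : Set Z) : Prop :=
  ∃ P : List ℕ → Set Z, (∀ s, IsClosed (P s)) ∧ A = souslinOperation P

/-- A metric space is absolute Souslin-F if it is a Souslin-F set in its metric completion. -/
def IsAbsoluteSouslinF (X : Type*) [MetricSpace X] : Prop :=
  IsSouslinF (Set.range ((↑) : X → UniformSpace.Completion X))

/-- The `F_σ` subsets, i.e. the countable unions of closed sets (in a metric space this is the
class of boldface `Σ⁰₂` sets). -/
def IsSigmaTwo {X : Type*} [TopologicalSpace X] (S : Set X) : Prop :=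
  ∃ F : ℕ → Set X, (∀ n, IsClosed (F n)) ∧ S = ⋃ n, F n

/-- `f` is `Σ⁰₂`-measurable: preimages of open sets are `Σ⁰₂`. -/
def SigmaTwoMeasurable {X Y : Type*} [TopologicalSpace X] [TopologicalSpace Y]
    (f : X → Y) : Prop :=
  ∀ U : Set Y, IsOpen U → IsSigmaTwo (f ⁻¹' U)

/-- `f` is piecewise continuous: `X` is covered by a sequence of closed sets on each of which the
restriction of `f` is continuous. -/
def PiecewiseContinuous {X Y : Type*} [TopologicalSpace X] [TopologicalSpace Y]
    (f : X → Y) : Prop :=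
  ∃ C : ℕ → Set X, (∀ n, IsClosed (C n)) ∧ (⋃ n, C n) = Set.univ ∧ ∀ n, ContinuousOn f (C n)

/-- `K` is a Cantor set: a homeomorphic copy of the Cantor space `2^ω`. -/
def IsCantorSet {X : Type*} [TopologicalSpace X] (K : Set X) : Prop :=
  Nonempty ((ℕ → Bool) ≃ₜ K)

end JayneRogers

/-! The sets covered by countably many closed sets of continuity of `f` form a σ-ideal, which is
local even without separability. If `A` is not in it, regularity of `Y` gives a point `x` and an
open `U ∋ f x` such that near `x` a large part of `A` is mapped outside `U`
(`exists_not_small_diff_preimage`). Iterating this gives a Cantor scheme. A 0-step keeps the point;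
a 1-step moves to a large part of `A` off `f ⁻¹' U`, refines the Souslin piece, and adds to a list
of closed sets to be avoided those whose union is `f ⁻¹' U`. An eventually zero branch converges to
its last point. A branch with infinitely many ones converges by the Souslin property, and its limit
lies outside `f ⁻¹' U` for every `U` at which it turned right. So `f` jumps at the image of each
eventually zero sequence; these sequences are dense, and Baire's theorem excludes piecewise
continuity. -/

namespace JayneRogers

open Set Filter Topology Metric PiNat

/-! ### The σ-ideal of small sets. -/

section Small

variable {X Y : Type*} [TopologicalSpace Y]

/-- `A` is small for `f` if it is covered by countably many closed sets of the ambient space on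
each of which `f` is continuous. -/
def Small [TopologicalSpace X] (f : X → Y) (A : Set X) : Prop :=
  ∃ C : ℕ → Set X, (∀ n, IsClosed (C n)) ∧ A ⊆ ⋃ n, C n ∧ ∀ n, ContinuousOn f (C n)

theorem Small.mono [TopologicalSpace X] {f : X → Y} {A B : Set X} (hB : Small f B) (h : A ⊆ B) :
    Small f A := by
  obtain ⟨C, h1, h2, h3⟩ := hB
  exact ⟨C, h1, h.trans h2, h3⟩

theorem small_iUnion [TopologicalSpace X] {f : X → Y} {A : ℕ → Set X} (h : ∀ n, Small f (A n)) :
    Small f (⋃ n, A n) := by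
  choose C h1 h2 h3 using h
  refine ⟨fun k => C k.unpair.1 k.unpair.2, fun k => h1 _ _, ?_, fun k => h3 _ _⟩
  refine iUnion_subset fun n x hx => ?_
  obtain ⟨m, hm⟩ := mem_iUnion.1 (h2 n hx)
  exact mem_iUnion.2 ⟨Nat.pair n m, by simpa using hm⟩

theorem Small.union [TopologicalSpace X] {f : X → Y} {A B : Set X} (hA : Small f A)
    (hB : Small f B) : Small f (A ∪ B) := by
  have h : ∀ n : ℕ, Small f (if n = 0 then A else B) := fun n => by split_ifs <;> assumption
  refine (small_iUnion h).mono (union_subset (fun x hx => ?_) fun x hx => ?_)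
  · exact mem_iUnion.2 ⟨0, by simpa using hx⟩
  · exact mem_iUnion.2 ⟨1, by simpa using hx⟩

theorem exists_not_small_of_subset_iUnion [TopologicalSpace X] {f : X → Y} {A : Set X}
    {S : ℕ → Set X} (hA : ¬ Small f A) (h : A ⊆ ⋃ n, S n) : ∃ n, ¬ Small f (A ∩ S n) := by
  by_contra! hc
  refine hA ((small_iUnion hc).mono fun x hx => ?_)
  obtain ⟨n, hn⟩ := mem_iUnion.1 (h hx)
  exact mem_iUnion.2 ⟨n, hx, hn⟩

theorem small_empty [TopologicalSpace X] (f : X → Y) : Small f ∅ :=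
  ⟨fun _ => ∅, fun _ => isClosed_empty, empty_subset _, fun _ => continuousOn_empty f⟩

/-- For open `U` these sets, with `ε = 1 / (n + 1)`, exhaust `U` by closed sets. -/
theorem isClosed_setOf_ball_subset [PseudoMetricSpace X] (U : Set X) (ε : ℝ) :
    IsClosed {x | ball x ε ⊆ U} := by
  have : {x | ball x ε ⊆ U} = ⋂ y ∈ Uᶜ, {x | ε ≤ dist y x} := by
    ext x
    simp only [mem_ofPred_eq, mem_iInter, mem_compl_iff]
    constructor
    · intro h y hy
      by_contra! hlt
      exact hy (h (mem_ball.2 hlt))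
    · intro h y hy
      by_contra hyU
      exact absurd (mem_ball.1 hy) (not_lt.2 (h y hyU))
  rw [this]
  exact isClosed_biInter fun y _ => isClosed_le continuous_const (continuous_const.dist continuous_id)

theorem IsOpen.exists_nat_ball_subset [PseudoMetricSpace X] {U : Set X} (hU : IsOpen U) {x : X}
    (hx : x ∈ U) : ∃ n : ℕ, ball x (1 / ((n : ℝ) + 1)) ⊆ U := by
  obtain ⟨ε, hε, h⟩ := Metric.isOpen_iff.1 hU x hx
  obtain ⟨n, hn⟩ := exists_nat_one_div_lt hε
  exact ⟨n, (ball_subset_ball hn.le).trans h⟩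

/-- Smallness is a local property, also in nonseparable metric spaces. -/
theorem small_of_locally_small [PseudoMetricSpace X] {f : X → Y} {B : Set X}
    (h : ∀ x ∈ B, ∃ V, IsOpen V ∧ x ∈ V ∧ Small f (B ∩ V)) : Small f B := by
  choose V hVo hV hs using fun x : B => h x x.2
  choose C hCc hCB hCf using hs
  -- Stone's trick: a point is assigned to the least index whose open set contains it. For fixed
  -- `n`, sets with distinct indices are at least `1 / (n + 1)` apart, hence locally finite, so
  -- unions over uncountably many indices stay closed and keep `f` continuous.
  let E : ℕ → B → Set X := fun n i =>
    {x | ball x (1 / ((n : ℝ) + 1)) ⊆ V i} ∩ ⋂ j, ⋂ _ : WellOrderingRel j i, (V j)ᶜ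
  have hEc : ∀ n i, IsClosed (E n i) := fun n i =>
    (isClosed_setOf_ball_subset _ _).inter
      (isClosed_iInter fun j => isClosed_iInter fun _ => (hVo j).isClosed_compl)
  have hsep : ∀ n i j x y, x ∈ E n i → y ∈ E n j → dist x y < 1 / ((n : ℝ) + 1) → i = j := by
    intro n i j x y hx hy hd
    rcases trichotomous_of WellOrderingRel i j with hij | hij | hij
    · have h1 : y ∈ V i := hx.1 (by rwa [mem_ball, dist_comm])
      exact absurd h1 (mem_iInter₂.1 hy.2 i hij)
    · exact hij
    · have h1 : x ∈ V j := hy.1 (by rwa [mem_ball])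
      exact absurd h1 (mem_iInter₂.1 hx.2 j hij)
  have hlf : ∀ n, LocallyFinite (E n) := by
    intro n x
    have hpos : (0 : ℝ) < 1 / ((n : ℝ) + 1) := Nat.one_div_pos_of_nat
    refine ⟨ball x (1 / ((n : ℝ) + 1) / 2), ball_mem_nhds _ (half_pos hpos), ?_⟩
    refine Set.Subsingleton.finite ?_
    rintro i ⟨y, hy, hyx⟩ j ⟨z, hz, hzx⟩
    refine hsep n i j y z hy hz ?_
    have h3 := dist_triangle_right y z x
    rw [mem_ball] at hyx hzx
    linarith
  have hcov : ∀ x ∈ B, ∃ n i, x ∈ E n i := by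
    intro x hx
    have hne : {i : B | x ∈ V i}.Nonempty := ⟨⟨x, hx⟩, hV ⟨x, hx⟩⟩
    have wf : WellFounded (WellOrderingRel (α := B)) := IsWellFounded.wf
    let i := wf.min _ hne
    have hi : x ∈ V i := wf.min_mem _ hne
    obtain ⟨n, hn⟩ := IsOpen.exists_nat_ball_subset (hVo i) hi
    exact ⟨n, i, hn, mem_iInter₂.2 fun j hj hxj => wf.not_lt_min {i : B | x ∈ V i} hxj hj⟩
  have hlf' : ∀ n m, LocallyFinite fun i => E n i ∩ C i m := fun n m =>
    (hlf n).subset fun i => inter_subset_left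
  have hS : ∀ n, Small f (⋃ i, ⋃ m, E n i ∩ C i m) := by
    intro n
    refine ⟨fun m => ⋃ i, E n i ∩ C i m, fun m => ?_, ?_, fun m => ?_⟩
    · exact (hlf' n m).isClosed_iUnion fun i => (hEc n i).inter (hCc i m)
    · rw [iUnion_comm]
    · exact (hlf' n m).continuousOn_iUnion (fun i => (hEc n i).inter (hCc i m))
        fun i => (hCf i m).mono inter_subset_right
  refine (small_iUnion hS).mono fun x hx => ?_
  obtain ⟨n, i, hi⟩ := hcov x hx
  have hxV : x ∈ V i := hi.1 (mem_ball_self Nat.one_div_pos_of_nat)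
  obtain ⟨m, hm⟩ := mem_iUnion.1 (hCB i ⟨hx, hxV⟩)
  exact mem_iUnion.2 ⟨n, mem_iUnion₂.2 ⟨i, m, hi, hm⟩⟩

/-- A set that is not small has a point near which a large part of it is mapped away from a
fixed neighbourhood of the value at that point. -/
theorem exists_not_small_diff_preimage [PseudoMetricSpace X] [RegularSpace Y] {f : X → Y}
    {A : Set X} (hA : ¬ Small f A) :
    ∃ (x : X) (U : Set Y), IsOpen U ∧ f x ∈ U ∧
      ∀ V, IsOpen V → x ∈ V → ¬ Small f ((A ∩ V) \ f ⁻¹' U) := by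
  by_contra! hc
  set D : Set X := {x | ∀ V, IsOpen V → x ∈ V → ¬ Small f (A ∩ V)} with hD
  have hDc : IsClosed D := by
    rw [← isOpen_compl_iff, isOpen_iff_forall_mem_open]
    intro x hx
    simp only [hD, mem_compl_iff, mem_ofPred_eq, not_forall, not_not] at hx
    obtain ⟨V, hVo, hxV, hV⟩ := hx
    exact ⟨V, fun y hy hyD => hyD V hVo hy hV, hVo, hxV⟩
  have h1 : Small f (A \ D) := by
    refine small_of_locally_small fun x hx => ?_
    have hx2 := hx.2
    simp only [hD, mem_ofPred_eq, not_forall, not_not] at hx2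
    obtain ⟨V, hVo, hxV, hV⟩ := hx2
    exact ⟨V, hVo, hxV, hV.mono (inter_subset_inter_left _ sdiff_subset)⟩
  have h2 : ContinuousOn f D := by
    intro x _
    rw [ContinuousWithinAt, tendsto_def]
    intro U hU
    obtain ⟨U₀, hU₀, hU₀c, hU₀U⟩ := exists_mem_nhds_isClosed_subset hU
    obtain ⟨V, hVo, hxV, hV⟩ := hc x (interior U₀) isOpen_interior (mem_interior_iff_mem_nhds.2 hU₀)
    rw [mem_nhdsWithin]
    refine ⟨V, hVo, hxV, fun y hy => ?_⟩
    by_contra hyU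
    -- Near `y` both the part of `A` mapped off `interior U₀` and the part mapped into `U₀` are
    -- small, and they cover `A` there, contradicting `y ∈ D`.
    obtain ⟨V', hVo', hyV', hV'⟩ := hc y U₀ᶜ hU₀c.isOpen_compl fun hyU₀ => hyU (hU₀U hyU₀)
    refine hy.2 (V ∩ V') (hVo.inter hVo') ⟨hy.1, hyV'⟩ ((hV.union hV').mono ?_)
    rintro z ⟨hzA, hzV, hzV'⟩
    by_cases hz : f z ∈ U₀
    · exact Or.inr ⟨⟨hzA, hzV'⟩, fun h => h hz⟩
    · exact Or.inl ⟨⟨hzA, hzV⟩, fun h => hz (interior_subset h)⟩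
  have h3 : Small f D := ⟨fun _ => D, fun _ => hDc, subset_iUnion (fun _ : ℕ => D) 0, fun _ => h2⟩
  exact hA ((h1.union h3).mono fun x hx => (em (x ∈ D)).elim Or.inr fun h => Or.inl ⟨hx, h⟩)

end Small

/-! ### Souslin schemes and the nodes of the Cantor scheme. -/

section Scheme

variable {X Y : Type*} [MetricSpace X] [TopologicalSpace Y]

/-- A Souslin scheme `Q ν n` (depending only on the first `n` values of `ν`) that witnesses a
completeness property of `X`. -/
structure IsCompleteScheme (Q : (ℕ → ℕ) → ℕ → Set X) : Prop where
  zero : ∀ ν, Q ν 0 = univ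
  succ : ∀ ν n, Q ν n ⊆ ⋃ k, Q (Function.update ν n k) (n + 1)
  anti : ∀ ν m n, m ≤ n → Q ν n ⊆ Q ν m
  congr : ∀ ν μ n, (∀ i < n, ν i = μ i) → Q ν n = Q μ n
  complete : ∀ ν (u : ℕ → X), CauchySeq u → (∀ n, ∀ᶠ m in atTop, u m ∈ closure (Q ν n)) →
    ∃ x, Tendsto u atTop (𝓝 x)

theorem initSeg_congr {ν μ : ℕ → ℕ} {n : ℕ} (h : ∀ i < n, ν i = μ i) :
    initSeg ν n = initSeg μ n := by
  unfold initSeg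
  congr 1
  ext i
  exact h i i.2

/-- `Q ν n` collects the points having a Souslin witness that starts with `ν|n`. A Cauchy sequence
eventually in every `closure (Q ν n)` has a limit in the completion; it lies in every closed `P
(ν|n)`, hence in `X`. -/
theorem IsAbsoluteSouslinF.exists_isCompleteScheme (hX : IsAbsoluteSouslinF X) :
    ∃ Q : (ℕ → ℕ) → ℕ → Set X, IsCompleteScheme Q := by
  obtain ⟨P, hPc, hP⟩ := hX
  refine ⟨fun ν n => {x | ∃ μ : ℕ → ℕ, (∀ i < n, μ i = ν i) ∧
    ∀ m, (x : UniformSpace.Completion X) ∈ P (initSeg μ m)}, ?_, ?_, ?_, ?_, ?_⟩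
  · intro ν
    refine eq_univ_of_forall fun x => ?_
    have hx : (x : UniformSpace.Completion X) ∈ souslinOperation P := hP ▸ mem_range_self x
    obtain ⟨μ, hμ⟩ := mem_iUnion.1 hx
    exact ⟨μ, by simp, mem_iInter.1 hμ⟩
  · rintro ν n x ⟨μ, h1, h2⟩
    refine mem_iUnion.2 ⟨μ n, μ, fun i hi => ?_, h2⟩
    rcases Nat.lt_succ_iff_lt_or_eq.1 hi with h | rfl
    · rw [Function.update_of_ne h.ne, h1 i h]
    · rw [Function.update_self]
  · rintro ν m n hmn x ⟨μ, h1, h2⟩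
    exact ⟨μ, fun i hi => h1 i (hi.trans_le hmn), h2⟩
  · intro ν μ n h
    ext x
    refine exists_congr fun κ => and_congr_left fun _ => forall₂_congr fun i hi => ?_
    rw [h i hi]
  · intro ν u hu hmem
    have hu' : CauchySeq fun n => (u n : UniformSpace.Completion X) :=
      hu.map (UniformSpace.Completion.uniformContinuous_coe X)
    obtain ⟨z, hz⟩ := cauchySeq_tendsto_of_complete hu'
    have hzP : ∀ n, z ∈ P (initSeg ν n) := by
      intro n
      refine (hPc _).mem_of_tendsto hz ((hmem n).mono fun m hm => ?_)
      have hcl : IsClosed ((↑) ⁻¹' P (initSeg ν n) : Set X) :=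
        (hPc _).preimage (UniformSpace.Completion.continuous_coe X)
      refine closure_minimal ?_ hcl hm
      rintro x ⟨μ, h1, h2⟩
      have := h2 n
      rwa [initSeg_congr h1] at this
    have hzr : z ∈ range ((↑) : X → UniformSpace.Completion X) :=
      hP ▸ mem_iUnion.2 ⟨ν, mem_iInter.2 hzP⟩
    obtain ⟨x, rfl⟩ := hzr
    exact ⟨x, (UniformSpace.Completion.isUniformInducing_coe X).isInducing.tendsto_nhds_iff.2 hz⟩

/-- The data attached to a node of the Cantor scheme: a set `A` inside a Souslin piece, closed
sets `F m` missed by `A`, and a ball around a point `x` near which large parts of `A` are mapped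
outside of the neighbourhood `U` of `f x`. -/
structure Node (f : X → Y) (Q : (ℕ → ℕ) → ℕ → Set X) where
  A : Set X
  ν : ℕ → ℕ
  n : ℕ
  F : ℕ → Set X
  x : X
  U : Set Y
  r : ℝ
  subset_piece : A ⊆ Q ν n
  isClosed_F : ∀ m, IsClosed (F m)
  disjoint_F : ∀ m, Disjoint A (F m)
  disjoint_closure_F : ∀ m < n, Disjoint (closure A) (F m)
  isOpen_U : IsOpen U
  apply_mem_U : f x ∈ U
  not_small : ∀ V, IsOpen V → x ∈ V → ¬ Small f ((A ∩ V) \ f ⁻¹' U)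
  r_pos : 0 < r

variable {f : X → Y} {Q : (ℕ → ℕ) → ℕ → Set X}

theorem mem_closure_of_not_small {A : Set X} {x : X} {U : Set Y}
    (h : ∀ V, IsOpen V → x ∈ V → ¬ Small f ((A ∩ V) \ f ⁻¹' U)) : x ∈ closure A := by
  rw [_root_.mem_closure_iff]
  intro V hV hx
  rw [inter_comm]
  by_contra hne
  rw [not_nonempty_iff_eq_empty] at hne
  exact h V hV hx (by rw [hne, empty_sdiff]; exact small_empty f)

/-- The relation between a node and its successor in either direction. -/
structure Node.Extends (S T : Node f Q) : Prop where
  subset : T.A ⊆ S.A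
  le : S.n ≤ T.n
  agree : ∀ i < S.n, T.ν i = S.ν i
  F_subset : ∀ m, S.F m ⊆ T.F m
  closedBall_subset : closedBall T.x T.r ⊆ closedBall S.x S.r
  r_le : T.r ≤ S.r / 2

/-- The large set `B` off `f ⁻¹' S.U` is cut down twice, by countable covers: into one Souslin
piece, then to points uniformly far from a closed set `H`. -/
theorem Node.exists_successors [RegularSpace Y] (hQ : IsCompleteScheme Q)
    (hf : SigmaTwoMeasurable f) (S : Node f Q) :
    ∃ T : Bool → Node f Q, (∀ b, S.Extends (T b)) ∧
      (T false).x = S.x ∧ (T false).U = S.U ∧ Disjoint (closedBall (T false).x (T false).r)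
        (closedBall (T true).x (T true).r) ∧
      (T true).n = S.n + 1 ∧ ∀ z, f z ∈ S.U → ∃ m, z ∈ (T true).F m := by
  obtain ⟨G, hGc, hG⟩ := hf S.U S.isOpen_U
  set B : Set X := (S.A ∩ ball S.x (S.r / 2)) \ f ⁻¹' S.U with hB
  have hBl : ¬ Small f B := S.not_small _ isOpen_ball (mem_ball_self (half_pos S.r_pos))
  obtain ⟨k, hk⟩ := exists_not_small_of_subset_iUnion (S := fun k =>
    Q (Function.update S.ν S.n k) (S.n + 1)) hBl
    fun y hy => hQ.succ _ _ (S.subset_piece hy.1.1)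
  -- Only finitely many closed sets are kept off the closure at each stage, so that `H` is closed;
  -- the point `S.x` is included to force the new center to differ from it.
  set H : Set X := insert S.x (⋃ m ∈ Finset.range (S.n + 1), (S.F m ∪ G m)) with hH
  have hHc : IsClosed H := by
    rw [hH, insert_eq]
    exact isClosed_singleton.union
      (isClosed_biUnion_finset fun m _ => (S.isClosed_F m).union (hGc m))
  have hBF : ∀ m, Disjoint B (S.F m ∪ G m) := by
    intro m
    rw [disjoint_left]
    rintro y hy (hyF | hyG)
    · exact disjoint_left.1 (S.disjoint_F m) hy.1.1 hyF
    · exact hy.2 (hG ▸ mem_iUnion.2 ⟨m, hyG⟩)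
  have hBH : Disjoint B H := by
    rw [disjoint_left]
    rintro y hy (rfl | hyH)
    · exact hy.2 S.apply_mem_U
    · obtain ⟨m, _, hm⟩ := mem_iUnion₂.1 hyH
      exact disjoint_left.1 (hBF m) hy hm
  obtain ⟨j, hj⟩ := exists_not_small_of_subset_iUnion
    (S := fun j : ℕ => {y | ball y (1 / ((j : ℝ) + 1)) ⊆ Hᶜ}) hk (fun y hy => by
      obtain ⟨j, hj⟩ := IsOpen.exists_nat_ball_subset hHc.isOpen_compl (x := y)
        (disjoint_left.1 hBH hy.1)
      exact mem_iUnion.2 ⟨j, hj⟩)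
  set A' : Set X := (B ∩ Q (Function.update S.ν S.n k) (S.n + 1)) ∩
    {y | ball y (1 / ((j : ℝ) + 1)) ⊆ Hᶜ} with hA'
  have hA'H : closure A' ⊆ Hᶜ := fun y hy =>
    (closure_minimal inter_subset_right (isClosed_setOf_ball_subset _ _) hy : ball y _ ⊆ Hᶜ)
      (mem_ball_self Nat.one_div_pos_of_nat)
  obtain ⟨x', U', hU'o, hxU', hx'⟩ := exists_not_small_diff_preimage hj
  have hx'A : x' ∈ closure A' := mem_closure_of_not_small hx'
  have hne : x' ≠ S.x := fun h => hA'H hx'A (h ▸ mem_insert _ _)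
  have hd : 0 < dist x' S.x := dist_pos.2 hne
  have hdr : dist x' S.x ≤ S.r / 2 := by
    have : A' ⊆ closedBall S.x (S.r / 2) := fun y hy => ball_subset_closedBall hy.1.1.1.2
    exact mem_closedBall.1 (closure_minimal this isClosed_closedBall hx'A)
  have hr := S.r_pos
  -- The bound `S.r / 2` nests the balls, since `x'` is within `S.r / 2` of `S.x`; a third of the
  -- distance makes them disjoint.
  have hρ : 0 < min (S.r / 2) (dist x' S.x / 3) := lt_min (half_pos hr) (by linarith)
  have hρ1 := min_le_left (S.r / 2) (dist x' S.x / 3)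
  have hρ2 := min_le_right (S.r / 2) (dist x' S.x / 3)
  let T₀ : Node f Q := { S with r := min (S.r / 2) (dist x' S.x / 3), r_pos := hρ }
  let T₁ : Node f Q :=
    { A := A'
      ν := Function.update S.ν S.n k
      n := S.n + 1
      F := fun m => S.F m ∪ G m
      x := x'
      U := U'
      r := min (S.r / 2) (dist x' S.x / 3)
      subset_piece := fun y hy => hy.1.2
      isClosed_F := fun m => (S.isClosed_F m).union (hGc m)
      disjoint_F := fun m => (hBF m).mono_left fun y hy => hy.1.1
      disjoint_closure_F := fun m hm => disjoint_left.2 fun y hy hyF =>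
        hA'H hy (mem_insert_of_mem _ (mem_iUnion₂.2 ⟨m, Finset.mem_range.2 hm, hyF⟩))
      isOpen_U := hU'o
      apply_mem_U := hxU'
      not_small := hx'
      r_pos := hρ }
  refine ⟨fun b => bif b then T₁ else T₀, ?_, rfl, rfl, ?_, rfl, ?_⟩
  · rintro (_ | _)
    · exact ⟨Subset.rfl, le_rfl, fun _ _ => rfl, fun _ => Subset.rfl,
        closedBall_subset_closedBall (hρ1.trans (by linarith)), hρ1⟩
    · refine ⟨fun y hy => hy.1.1.1.1, Nat.le_succ _, fun i hi => Function.update_of_ne hi.ne _ _,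
        fun m => subset_union_left, ?_, hρ1⟩
      refine closedBall_subset_closedBall' ?_
      change min _ _ + dist x' S.x ≤ S.r
      linarith
  · refine closedBall_disjoint_closedBall ?_
    change min _ _ + min _ _ < dist S.x x'
    rw [dist_comm S.x x']
    linarith
  · intro z hz
    have hz' : z ∈ f ⁻¹' S.U := hz
    rw [hG] at hz'
    obtain ⟨m, hm⟩ := mem_iUnion.1 hz'
    exact ⟨m, Or.inr hm⟩

theorem Node.exists_of_not_small [RegularSpace Y] (hQ : IsCompleteScheme Q)
    (h : ¬ Small f univ) : Nonempty (Node f Q) := by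
  obtain ⟨x, U, hU, hxU, hx⟩ := exists_not_small_diff_preimage h
  exact ⟨⟨univ, 0, 0, fun _ => ∅, x, U, 1, by rw [hQ.zero], by simp, by simp, by simp, hU, hxU, hx,
    one_pos⟩⟩

/-- The tree of nodes generated by a root and a successor function. -/
def nodeTree (root : Node f Q) (next : Node f Q → Bool → Node f Q) : List Bool → Node f Q
  | [] => root
  | b :: s => next (nodeTree root next s) b

/-! ### Limits along a branch. -/

section Branch

variable {T : ℕ → Node f Q}

theorem extends_le (hT : ∀ n, (T n).Extends (T (n + 1))) {i j : ℕ} (hij : i ≤ j) :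
    (T j).A ⊆ (T i).A ∧ (T i).n ≤ (T j).n ∧ (∀ l < (T i).n, (T j).ν l = (T i).ν l) ∧
      (∀ m, (T i).F m ⊆ (T j).F m) ∧ closedBall (T j).x (T j).r ⊆ closedBall (T i).x (T i).r := by
  induction j, hij using Nat.le_induction with
  | base => exact ⟨Subset.rfl, le_rfl, fun _ _ => rfl, fun _ => Subset.rfl, Subset.rfl⟩
  | succ j hij ih =>
    obtain ⟨h1, h2, h3, h4, h5⟩ := ih
    have h := hT j
    exact ⟨h.subset.trans h1, h2.trans h.le,
      fun l hl => (h.agree l (hl.trans_le h2)).trans (h3 l hl),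
      fun m => (h4 m).trans (h.F_subset m), h.closedBall_subset.trans h5⟩

theorem tendsto_radius (hT : ∀ n, (T n).Extends (T (n + 1))) :
    Tendsto (fun n => (T n).r) atTop (𝓝 0) := by
  have hle : ∀ n, (T n).r ≤ (T 0).r * (1 / 2) ^ n := by
    intro n
    induction n with
    | zero => simp
    | succ n ih =>
      have := (hT n).r_le
      rw [pow_succ]
      linarith
  have hlim : Tendsto (fun n : ℕ => (T 0).r * (1 / 2 : ℝ) ^ n) atTop (𝓝 0) := by
    simpa using (tendsto_pow_atTop_nhds_zero_of_lt_one (r := (1 / 2 : ℝ)) (by norm_num)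
      (by norm_num)).const_mul (T 0).r
  exact squeeze_zero (fun n => (T n).r_pos.le) hle hlim

theorem tendsto_centers_of_mem (hT : ∀ n, (T n).Extends (T (n + 1))) {z : X}
    (hz : ∀ n, z ∈ closedBall (T n).x (T n).r) : Tendsto (fun n => (T n).x) atTop (𝓝 z) := by
  rw [tendsto_iff_dist_tendsto_zero]
  refine squeeze_zero (fun n => dist_nonneg) (fun n => ?_) (tendsto_radius hT)
  rw [dist_comm]
  exact mem_closedBall.1 (hz n)

theorem mem_closure_of_forall_mem_closedBall (hT : ∀ n, (T n).Extends (T (n + 1))) {z : X}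
    (hz : ∀ n, z ∈ closedBall (T n).x (T n).r) (n : ℕ) : z ∈ closure (T n).A :=
  isClosed_closure.mem_of_tendsto (tendsto_centers_of_mem hT hz)
    ((eventually_ge_atTop n).mono fun _ hm =>
      closure_mono (extends_le hT hm).1 (mem_closure_of_not_small (T _).not_small))

theorem iInter_closedBall_nonempty (hQ : IsCompleteScheme Q)
    (hT : ∀ n, (T n).Extends (T (n + 1))) (hn : ∀ k, ∃ i, k ≤ (T i).n) :
    (⋂ n, closedBall (T n).x (T n).r).Nonempty := by
  have hmem : ∀ n m, n ≤ m → (T m).x ∈ closedBall (T n).x (T n).r := fun n m h =>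
    (extends_le hT h).2.2.2.2 (mem_closedBall_self (T m).r_pos.le)
  have hC : CauchySeq fun n => (T n).x := by
    refine cauchySeq_of_le_tendsto_0' (fun n => (T n).r) (fun n m h => ?_) (tendsto_radius hT)
    rw [dist_comm]
    exact mem_closedBall.1 (hmem n m h)
  -- At depth `i k` more than `k` entries are frozen, so the diagonal sequence of their `k`-th
  -- entries agrees with every node on its frozen part.
  choose i hi using fun k => hn (k + 1)
  obtain ⟨z, hz⟩ := hQ.complete (fun k => (T (i k)).ν k) _ hC (by
    intro k
    filter_upwards [eventually_ge_atTop (i k)] with m hm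
    have hkm : k ≤ (T m).n := (Nat.le_succ k).trans ((hi k).trans (extends_le hT hm).2.1)
    have hcong : Q (fun k => (T (i k)).ν k) k = Q (T m).ν k := by
      refine hQ.congr _ _ _ fun l hl => ?_
      rcases le_total m (i l) with h | h
      · exact (extends_le hT h).2.2.1 l (hl.trans_le hkm)
      · exact ((extends_le hT h).2.2.1 l (hi l)).symm
    rw [hcong]
    exact closure_mono ((T m).subset_piece.trans (hQ.anti _ _ _ hkm))
      (mem_closure_of_not_small (T m).not_small))
  exact ⟨z, mem_iInter.2 fun n => isClosed_closedBall.mem_of_tendsto hz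
    ((eventually_ge_atTop n).mono fun m hm => hmem n m hm)⟩

/-- The limit is in the closure of every `(T l).A`, and each listed closed set is eventually
disjoint from these closures; the list covers the preimage of `(T i).U`. -/
theorem apply_notMem_of_forall_mem_closedBall (hT : ∀ n, (T n).Extends (T (n + 1)))
    (hn : ∀ k, ∃ i, k ≤ (T i).n) {z : X} (hz : ∀ n, z ∈ closedBall (T n).x (T n).r) {i : ℕ}
    (hi : ∀ y, f y ∈ (T i).U → ∃ m, y ∈ (T (i + 1)).F m) : f z ∉ (T i).U := by
  intro hzU
  obtain ⟨m, hm⟩ := hi z hzU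
  obtain ⟨j, hj⟩ := hn (m + 1)
  set l := max j (i + 1)
  have hml : m < (T l).n := hj.trans (extends_le hT (le_max_left j (i + 1))).2.1
  exact disjoint_left.1 ((T l).disjoint_closure_F m hml)
    (mem_closure_of_forall_mem_closedBall hT hz l)
    ((extends_le hT (le_max_right j (i + 1))).2.2.2.1 m hm)

end Branch

/-! ### The Cantor scheme and its induced map. -/

/-- Every `f` that is `Σ⁰₂`-measurable and not piecewise continuous admits a continuous injection
of the Cantor space such that densely many points have arbitrarily close points with values outside
of a fixed neighbourhood. -/
theorem exists_continuous_injective [RegularSpace Y] (hQ : IsCompleteScheme Q)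
    (hf : SigmaTwoMeasurable f) (h : ¬ Small f univ) :
    ∃ φ : (ℕ → Bool) → X, Continuous φ ∧ Function.Injective φ ∧
      ∀ (y : ℕ → Bool) (m : ℕ), (∀ i, m ≤ i → y i = false) → ∃ U : Set Y, IsOpen U ∧ f (φ y) ∈ U ∧
        ∀ (w : ℕ → Bool) (k : ℕ), (∀ i < m, w i = y i) → m ≤ k →
          (∀ i, m ≤ i → i < k → w i = false) → (∀ i, k ≤ i → w i = true) → f (φ w) ∉ U := by
  obtain ⟨root⟩ := Node.exists_of_not_small hQ h
  choose next hext hx hU hdisj hn hF using Node.exists_successors hQ hf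
  let T := nodeTree root next
  let A : List Bool → Set X := fun s => closedBall (T s).x (T s).r
  have hT : ∀ y : ℕ → Bool, ∀ n, (T (res y n)).Extends (T (res y (n + 1))) := fun y n =>
    hext (T (res y n)) (y n)
  have hconst : ∀ (y : ℕ → Bool) (m k : ℕ), m ≤ k → (∀ i, m ≤ i → i < k → y i = false) →
      (T (res y k)).x = (T (res y m)).x ∧ (T (res y k)).U = (T (res y m)).U := by
    intro y m k hmk
    induction k, hmk using Nat.le_induction with
    | base => exact fun _ => ⟨rfl, rfl⟩
    | succ k hmk ih =>
      intro hy
      obtain ⟨ih1, ih2⟩ := ih fun i h1 h2 => hy i h1 (h2.trans (Nat.lt_succ_self k))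
      rw [← ih1, ← ih2]
      change (next (T (res y k)) (y k)).x = _ ∧ (next (T (res y k)) (y k)).U = _
      rw [hy k hmk (Nat.lt_succ_self k)]
      exact ⟨hx _, hU _⟩
  have hinf : ∀ y : ℕ → Bool, (∀ m, ∃ i, m ≤ i ∧ y i = true) →
      ∀ k, ∃ i, k ≤ (T (res y i)).n := by
    intro y hy k
    induction k with
    | zero => exact ⟨0, Nat.zero_le _⟩
    | succ k ih =>
      obtain ⟨j, hj⟩ := ih
      obtain ⟨i, hji, hi⟩ := hy j
      refine ⟨i + 1, ?_⟩
      change k + 1 ≤ (next (T (res y i)) (y i)).n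
      rw [hi, hn]
      exact Nat.succ_le_succ (hj.trans (extends_le (T := fun n => T (res y n)) (hT y) hji).2.1)
  have hne : ∀ y, (⋂ n, A (res y n)).Nonempty := by
    intro y
    -- Completeness is needed only with infinitely many ones; otherwise the centers stabilize and
    -- their final value lies in all the balls.
    by_cases hy : ∀ m, ∃ i, m ≤ i ∧ y i = true
    · exact iInter_closedBall_nonempty (T := fun n => T (res y n)) hQ (hT y) (hinf y hy)
    · push Not at hy
      obtain ⟨m, hm⟩ := hy
      refine ⟨(T (res y m)).x, mem_iInter.2 fun n => ?_⟩
      have h1 := (hconst y m (max m n) (le_max_left _ _) fun i hi _ => by simpa using hm i hi).1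
      rw [← h1]
      exact (extends_le (T := fun n => T (res y n)) (hT y) (le_max_right m n)).2.2.2.2
        (mem_closedBall_self (T _).r_pos.le)
  have hdiam : CantorScheme.VanishingDiam A := by
    intro y
    have h1 := tendsto_radius (T := fun n => T (res y n)) (hT y)
    have h2 : Tendsto (fun n => 2 * ENNReal.ofReal (T (res y n)).r) atTop (𝓝 0) := by
      simpa using ENNReal.Tendsto.const_mul (a := 2) (ENNReal.tendsto_ofReal h1)
        (Or.inr (by norm_num))
    refine tendsto_of_tendsto_of_tendsto_of_le_of_le tendsto_const_nhds h2 (fun _ => zero_le) ?_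
    intro n
    change ediam (closedBall _ _) ≤ _
    rw [← Metric.closedEBall_ofReal (T (res y n)).r_pos.le]
    exact ediam_closedEBall_le
  have hdis : CantorScheme.Disjoint A := by
    rintro l (_ | _) (_ | _) hab
    · exact absurd rfl hab
    · exact hdisj (T l)
    · exact (hdisj (T l)).symm
    · exact absurd rfl hab
  let φ : (ℕ → Bool) → X := fun y => (CantorScheme.inducedMap A).2 ⟨y, hne y⟩
  have hφ : ∀ y n, φ y ∈ closedBall (T (res y n)).x (T (res y n)).r := fun y n =>
    CantorScheme.map_mem (A := A) ⟨y, hne y⟩ n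
  refine ⟨φ, hdiam.map_continuous.comp (by fun_prop), fun y w hyw =>
    congrArg Subtype.val (hdis.map_injective hyw), fun y m hy => ?_⟩
  have hxy : φ y = (T (res y m)).x := by
    refine tendsto_nhds_unique (tendsto_centers_of_mem (T := fun n => T (res y n)) (hT y) (hφ y)) ?_
    refine tendsto_const_nhds.congr' ?_
    filter_upwards [eventually_ge_atTop m] with k hk
    exact (hconst y m k hk fun i hi _ => hy i hi).1.symm
  refine ⟨(T (res y m)).U, (T (res y m)).isOpen_U, hxy ▸ (T (res y m)).apply_mem_U, ?_⟩
  intro w k hwy hmk hw0 hw1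
  have hres : res w m = res y m := res_eq_res.2 fun i hi => hwy i hi
  -- The zeros between `m` and `k` preserve `U`, so the one at `k` is a right turn at this same `U`.
  rw [← hres, ← (hconst w m k hmk hw0).2]
  refine apply_notMem_of_forall_mem_closedBall (T := fun n => T (res w n)) (hT w)
    (hinf w fun j => ⟨max j k, le_max_left _ _, hw1 _ (le_max_right _ _)⟩) (hφ w) fun z hz => ?_
  change ∃ l, z ∈ (next (T (res w k)) (w k)).F l
  rw [hw1 k le_rfl]
  exact hF _ z hz

end Scheme

/-! ### The Baire category argument and the conclusion. -/

/-- A function on the Cantor space that jumps at every eventually zero sequence is not piecewise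
continuous. -/
theorem not_piecewiseContinuous_of_jumps {Y : Type*} [TopologicalSpace Y] {f : (ℕ → Bool) → Y}
    (h : ∀ (y : ℕ → Bool) (m : ℕ), (∀ i, m ≤ i → y i = false) → ∃ U : Set Y, IsOpen U ∧ f y ∈ U ∧
      ∀ (w : ℕ → Bool) (k : ℕ), (∀ i < m, w i = y i) → m ≤ k →
        (∀ i, m ≤ i → i < k → w i = false) → (∀ i, k ≤ i → w i = true) → f w ∉ U) :
    ¬ PiecewiseContinuous f := by
  rintro ⟨C, hC, hcov, hcont⟩
  obtain ⟨n, y, hy⟩ := nonempty_interior_of_iUnion_of_closed hC hcov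
  obtain ⟨_, ⟨v, m, rfl⟩, hyv, hv⟩ :=
    (isTopologicalBasis_cylinders fun _ : ℕ => Bool).exists_subset_of_mem_open hy isOpen_interior
  let a : ℕ → Bool := fun i => if i < m then v i else false
  have ha : a ∈ interior (C n) := hv (mem_cylinder_iff.2 fun i hi => if_pos hi)
  obtain ⟨U, hU, haU, hw⟩ := h a m fun i hi => if_neg (not_lt.2 hi)
  have hcts : ContinuousAt f a := (hcont n).continuousAt (mem_interior_iff_mem_nhds.1 ha)
  -- These converge to `a`, where `f` is continuous, yet their values avoid `U` for `k ≥ m`.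
  let b : ℕ → ℕ → Bool := fun k i => if i < k then a i else true
  have hb : Tendsto b atTop (𝓝 a) := by
    refine tendsto_pi_nhds.2 fun i => tendsto_const_nhds.congr' ?_
    filter_upwards [eventually_gt_atTop i] with k hk
    exact (if_pos hk).symm
  obtain ⟨k, hk, hmk⟩ := (((hcts.tendsto.comp hb).eventually (hU.mem_nhds haU)).and
    (eventually_ge_atTop m)).exists
  refine hw (b k) k (fun i hi => if_pos (hi.trans_le hmk)) hmk (fun i hi hik => ?_)
    (fun i hi => if_neg (not_lt.2 hi)) hk
  exact (if_pos hik).trans (if_neg (not_lt.2 hi))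

end JayneRogers

theorem corollary4 {X Y : Type*} [MetricSpace X] [TopologicalSpace Y] [RegularSpace Y]
    (hX : JayneRogers.IsAbsoluteSouslinF X) (f : X → Y)
    (hf : JayneRogers.SigmaTwoMeasurable f) (hpc : ¬ JayneRogers.PiecewiseContinuous f) :
    ∃ K : Set X, JayneRogers.IsCantorSet K ∧
      JayneRogers.SigmaTwoMeasurable (K.domRestrict f) ∧
      ¬ JayneRogers.PiecewiseContinuous (K.domRestrict f) := by
  have hsmall : ¬ JayneRogers.Small f Set.univ := fun ⟨C, h1, h2, h3⟩ =>
    hpc ⟨C, h1, Set.univ_subset_iff.1 h2, h3⟩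
  obtain ⟨Q, hQ⟩ := hX.exists_isCompleteScheme
  obtain ⟨φ, hφc, hφi, hφ⟩ :=
    JayneRogers.exists_continuous_injective hQ hf hsmall
  -- Compactness of the Cantor space makes the continuous injection `φ` an embedding; a
  -- piecewise-continuity cover of its range pulls back to one for `f ∘ φ`.
  refine ⟨Set.range φ, ⟨(hφc.isClosedEmbedding hφi).isEmbedding.toHomeomorph⟩, ?_, ?_⟩
  · intro U hU
    obtain ⟨F, hF, h⟩ := hf U hU
    refine ⟨fun n => Subtype.val ⁻¹' F n, fun n => (hF n).preimage continuous_subtype_val, ?_⟩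
    rw [← Set.preimage_iUnion, ← h]
    rfl
  · rintro ⟨C, hC, hcov, hcont⟩
    have hψ : Continuous (Set.rangeFactorization φ) := hφc.subtype_mk _
    refine JayneRogers.not_piecewiseContinuous_of_jumps (f := f ∘ φ) hφ
      ⟨fun n => Set.rangeFactorization φ ⁻¹' C n, fun n => (hC n).preimage hψ, ?_, fun n => ?_⟩
    · rw [← Set.preimage_iUnion, hcov, Set.preimage_univ]
    · exact (hcont n).comp hψ.continuousOn (Set.mapsTo_preimage _ _)
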